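/- Let $G$ be a connected Lie group whose Lie algebra is $\mathfrak{g}_{4,3}$, i.e. $\mathfrak g$ has a basis $(E_1,E_2,E_3,E_4)$ whose only nonzero brackets (up to antisymmetry) are $[E_1,E_4]=E_1$ and $[E_3,E_4]=E_2$. Let $d_1$ be the left-invariant sub-Riemannian metric on $G$ defined by the subspace $\mathfrak p=\mathrm{span}(E_1,E_3,E_4)\subset\mathfrak g$ and the inner product on $\mathfrak p$ for which $(E_1,E_3,E_4)$ is an orthonormal basis; let $\|\cdot\|$ be the norm of this inner product. The length of an absolutely continuous horizontal curve $\gamma$, $\dot\gamma(t)=dl_{\gamma(t)}(u(t))$ with $u(t)\in\mathfrak p$ measurable and $l_x(y)=xy$, is $\int\|u(t)\|\,dt$; $d_1(x,y)$ is the infimum of the lengths of such curves from $x$ to $y$; a segment of a curve is called shortest if it is horizontal and its length equals the $d_1$-distance between its ends; a geodesic is a curve all of whose sufficiently short segments are shortest. Let $\gamma:\mathbb R\to G$ be a horizontal curve with control $u$, $\|u(t)\|=1$ for almost all $t$. It satisfies the Pontryagin maximum principle with a nowhere zero, locally absolutely continuous function $\psi:\mathbb R\to\mathfrak g^*$ and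 a constant $M\ge 0$ if for each $v\in\mathfrak g$ one has $(\psi(t)(v))'=\psi(t)([u(t),v])$ for almost all $t$, and $\psi(t)(u(t))=\max\{\psi(t)(w): w\in\mathfrak p,\ \|w\|\le 1\}=M$ for almost all $t$. The curve $\gamma$ is an abnormal (normal) extremal if this holds for some $\psi$ with $M=0$ (with some $M>0$), and a strictly abnormal extremal if it is an abnormal extremal and not a normal one. Then for $s=1$ and for $s=-1$ the curve $g(t)=\exp(stE_1)$, $t\in\mathbb R$, is a strictly abnormal extremal which is not a geodesic; moreover, for no $t_0<t_1$ is the segment $g(t)$, $t\in[t_0,t_1]$, shortest. -/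

import Mathlib

open Set MeasureTheory
open scoped Manifold ContDiff ENNReal

noncomputable section SubRiemannianLieGroup

variable {E : Type*} [NormedAddCommGroup E] [NormedSpace ℝ E]
  {G : Type*} [TopologicalSpace G] [ChartedSpace E G] [Group G]

/-- The exponential map of a Lie group: `lieExp X` is the value at time `1` of the integral curve,
starting at the unit, of the left-invariant vector field with value `X` at the unit. (On a Lie
group this integral curve exists and is unique, so the second branch never occurs there.) -/
def lieExp (X : GroupLieAlgebra 𝓘(ℝ, E) G) : G :=
  open Classical in
  if h : ∃ γ : ℝ → G, γ 0 = 1 ∧ IsMIntegralCurve (I := 𝓘(ℝ, E)) γ (mulInvariantVectorField X) then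
    h.choose 1
  else 1

/-- `(E₁, E₂, E₃, E₄) = (b 0, b 1, b 2, b 3)` is a basis of the Lie algebra of `G` in which the
bracket is that of the Lie algebra `𝔤_{4,3}`: the only nonzero brackets of basis vectors are
`[E₁, E₄] = E₁` and `[E₃, E₄] = E₂` (and their opposites). -/
structure IsG43Basis (b : Module.Basis (Fin 4) ℝ (GroupLieAlgebra 𝓘(ℝ, E) G)) : Prop where
  lie_one_two : ⁅b 0, b 1⁆ = 0
  lie_one_three : ⁅b 0, b 2⁆ = 0
  lie_one_four : ⁅b 0, b 3⁆ = b 0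
  lie_two_three : ⁅b 1, b 2⁆ = 0
  lie_two_four : ⁅b 1, b 3⁆ = 0
  lie_three_four : ⁅b 2, b 3⁆ = b 1

variable (E G) in
/-- A left-invariant sub-Riemannian structure on `G`: a subspace `p` of the Lie algebra (it
determines the left-invariant distribution) with an inner product on it. That `p` generates the
Lie algebra is not a field: none of the definitions below depends on it, and it holds automatically
for `p = span (E₁, E₃, E₄)` in `𝔤_{4,3}`, because `E₂ = [E₃, E₄]`. -/
structure LeftInvariantSubRiemannian where
  /-- the value at the unit of the left-invariant distribution -/
  p : Submodule ℝ (GroupLieAlgebra 𝓘(ℝ, E) G)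
  /-- the inner product on `p` -/
  core : InnerProductSpace.Core ℝ p

namespace LeftInvariantSubRiemannian

/-- The structure on the span of a linearly independent family `e`, with the inner product for
which `e` is an orthonormal basis. -/
def ofOrthonormal {ι : Type*} [Fintype ι] (e : ι → GroupLieAlgebra 𝓘(ℝ, E) G)
    (he : LinearIndependent ℝ e) : LeftInvariantSubRiemannian E G where
  p := Submodule.span ℝ (range e)
  core :=
    { inner := fun v w => ∑ i, (Module.Basis.span he).repr v i * (Module.Basis.span he).repr w i
      conj_inner_symm := fun v w => by simp [mul_comm]
      re_inner_nonneg := fun v => by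
        simpa using Finset.sum_nonneg fun i _ => mul_self_nonneg _
      add_left := fun u v w => by simp [add_mul, Finset.sum_add_distrib]
      smul_left := fun u v r => by simp [Finset.mul_sum, mul_assoc]
      definite := fun v h => by
        have h' := (Finset.sum_eq_zero_iff_of_nonneg fun i _ => mul_self_nonneg _).1 h
        apply (Module.Basis.span he).repr.injective
        ext i
        simpa using h' i (Finset.mem_univ i) }

variable (S : LeftInvariantSubRiemannian E G)

/-- The norm on `p` defined by the inner product. -/
def norm (v : S.p) : ℝ := Real.sqrt (S.core.inner v v)

/-- `γ` is, on `[a, b]`, an absolutely continuous horizontal curve with control `u`: its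
compositions with smooth functions are absolutely continuous, and `γ' (t) = dl_{γ (t)} (u (t))`
for almost all `t` in `[a, b]`, where `u` is a measurable function with values in `p`. -/
structure IsHorizontal (γ : ℝ → G) (u : ℝ → S.p) (a b : ℝ) : Prop where
  continuousOn : ContinuousOn γ (Icc a b)
  absolutelyContinuous : ∀ f : G → ℝ, ContMDiff 𝓘(ℝ, E) 𝓘(ℝ, ℝ) ∞ f →
    AbsolutelyContinuousOnInterval (fun t => f (γ t)) a b
  aemeasurable : ∀ l : Module.Dual ℝ S.p,
    AEMeasurable (fun t => l (u t)) (volume.restrict (Icc a b))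
  hasMFDerivAt : ∀ᵐ t ∂volume.restrict (Icc a b),
    HasMFDerivAt 𝓘(ℝ, ℝ) 𝓘(ℝ, E) γ t
      ((1 : ℝ →L[ℝ] ℝ).smulRight
        (mulInvariantVectorField (u t : GroupLieAlgebra 𝓘(ℝ, E) G) (γ t)))

/-- The length on `[a, b]` of a horizontal curve with control `u`. (The control of a curve is
determined by the curve up to a null set.) -/
def length (u : ℝ → S.p) (a b : ℝ) : ℝ≥0∞ :=
  ∫⁻ t in Icc a b, ENNReal.ofReal (S.norm (u t))

/-- The left-invariant sub-Riemannian distance: the infimum of the lengths of the horizontal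
curves from `x` to `y` (`∞` if there is none). -/
def dist (x y : G) : ℝ≥0∞ :=
  ⨅ (γ : ℝ → G) (u : ℝ → S.p) (_ : S.IsHorizontal γ u 0 1 ∧ γ 0 = x ∧ γ 1 = y), S.length u 0 1

/-- The segment `γ (t)`, `t ∈ [a, b]`, is shortest: it is a horizontal curve, the length of which
is the distance between its ends. -/
def IsShortest (γ : ℝ → G) (a b : ℝ) : Prop :=
  ∃ u : ℝ → S.p, S.IsHorizontal γ u a b ∧ S.length u a b = S.dist (γ a) (γ b)

/-- `γ` is a geodesic: every sufficiently short segment of it is shortest. -/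
def IsGeodesic (γ : ℝ → G) : Prop :=
  ∀ t : ℝ, ∃ ε > 0, ∀ a b : ℝ, t - ε < a → a < b → b < t + ε → S.IsShortest γ a b

/-- The curve `γ : ℝ → G`, parameterized by arc length, satisfies the Pontryagin maximum principle
for the time-optimal problem `γ' = dl_γ (u)`, `u ∈ U = {v ∈ p | ‖v‖ ≤ 1}`, with the control `u`,
the covector function `ψ` and the maximum `M`. The covector `ψ (t)` at `γ (t)` is identified with
an element of the dual of the Lie algebra by left translation; then the Hamiltonian system for `ψ`
is `(ψ (t) (v))' = ψ (t) ([u (t), v])`. -/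
structure SatisfiesPMP (γ : ℝ → G) (u : ℝ → S.p)
    (ψ : ℝ → Module.Dual ℝ (GroupLieAlgebra 𝓘(ℝ, E) G)) (M : ℝ) : Prop where
  isHorizontal : ∀ a b : ℝ, a < b → S.IsHorizontal γ u a b
  norm_eq_one : ∀ᵐ t, S.norm (u t) = 1
  absolutelyContinuous : ∀ v : GroupLieAlgebra 𝓘(ℝ, E) G, ∀ a b : ℝ, a < b →
    AbsolutelyContinuousOnInterval (fun t => ψ t v) a b
  ne_zero : ∀ t, ψ t ≠ 0
  hasDerivAt : ∀ v : GroupLieAlgebra 𝓘(ℝ, E) G, ∀ᵐ t,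
    HasDerivAt (fun r => ψ r v) (ψ t ⁅(u t : GroupLieAlgebra 𝓘(ℝ, E) G), v⁆) t
  maximum : ∀ᵐ t, ∀ v : S.p, S.norm v ≤ 1 → ψ t v ≤ ψ t (u t)
  eq_maximum : ∀ᵐ t, ψ t (u t) = M

/-- `γ : ℝ → G` is an abnormal extremal: it satisfies the maximum principle with `M = 0`. -/
def IsAbnormalExtremal (γ : ℝ → G) : Prop := ∃ u ψ, S.SatisfiesPMP γ u ψ 0

/-- `γ : ℝ → G` is a normal extremal: it satisfies the maximum principle with some `M > 0`. -/
def IsNormalExtremal (γ : ℝ → G) : Prop := ∃ u ψ M, 0 < M ∧ S.SatisfiesPMP γ u ψ M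

/-- `γ` is a strictly abnormal extremal: it is abnormal and is not at the same time normal. -/
def IsStrictlyAbnormalExtremal (γ : ℝ → G) : Prop :=
  S.IsAbnormalExtremal γ ∧ ¬ S.IsNormalExtremal γ

end LeftInvariantSubRiemannian

/-- The left-invariant sub-Riemannian structure on `p = span (E₁, E₃, E₄)` with the inner product
for which `(E₁, E₃, E₄)` is an orthonormal basis, where `(E₁, E₂, E₃, E₄) = (b 0, b 1, b 2, b 3)`. -/
def subRiemannian134 (b : Module.Basis (Fin 4) ℝ (GroupLieAlgebra 𝓘(ℝ, E) G)) :
    LeftInvariantSubRiemannian E G :=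
  LeftInvariantSubRiemannian.ofOrthonormal (b ∘ ![0, 2, 3])
    (b.linearIndependent.comp _ (by decide))

end SubRiemannianLieGroup

/-! Since `[E₄, E₁] = -E₁`, the horizontal vectors `E₁`, `E₄` span a subalgebra, and the
left-invariant metric with this orthonormal frame on the corresponding subgroup is that of the
hyperbolic plane. There `exp (s t E₁)` runs along a horocycle. A horocyclic arc of length `2 sinh a`
has its ends joined by a hyperbolic geodesic of length `2 a`, which is also horizontal in `G`; as `a
< sinh a` for `a > 0`, no arc is shortest (`dist_curve_le`, `not_isShortest_curve`).

The curve is abnormal with the constant covector dual to `E₂`: it kills `p` and also `[E₁, 𝔤] = ℝ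
E₁`. It is not normal: if `M > 0`, then `ψ (s E₁) = M` and maximality over the unit ball force `ψ
(E₄) = 0`, whereas `ψ (E₄)' = ψ ([s E₁, E₄]) = ψ (s E₁) = M`.

To verify the shortcut one needs the velocity of `exp (x E₁) exp (z E₄)`. It follows from the
product rule `HasVelocityAt.mul`, which involves `Ad`, and from `Ad (exp (t X)) Y = e^{c t} Y` when
`[X, Y] = c Y`. The latter rests on `d/dt Ad (exp (t X)) Y = [X, Y]` at `t = 0`, proved by computing
both sides from the second derivative of the multiplication in a chart at the unit. -/

open Filter Topology

/-! ### Left-trivialized velocities of curves and the product rule -/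

section LieGroupChart

set_option linter.unusedSectionVars false

variable {E : Type*} [NormedAddCommGroup E] [NormedSpace ℝ E]
  {G : Type*} [TopologicalSpace G] [ChartedSpace E G] [Group G] [LieGroup 𝓘(ℝ, E) ∞ G]

theorem lieGroup_minSmoothness_three (E : Type*) [NormedAddCommGroup E] [NormedSpace ℝ E]
    (G : Type*) [TopologicalSpace G] [ChartedSpace E G] [Group G] [LieGroup 𝓘(ℝ, E) ∞ G] :
    LieGroup 𝓘(ℝ, E) (minSmoothness ℝ 3) G :=
  LieGroup.of_le (n := ∞)
    (by rw [minSmoothness_of_isRCLikeNormedField]; exact WithTop.coe_le_coe.2 le_top)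

theorem contMDiffAt_chartAt_one :
    ContMDiffAt 𝓘(ℝ, E) 𝓘(ℝ, E) ∞ (chartAt E (1 : G)) 1 :=
  have : IsManifold 𝓘(ℝ, E) ∞ G := inferInstance
  contMDiffOn_chart.contMDiffAt (chart_source_mem_nhds E (1 : G))

theorem contMDiffAt_chartAt_one_symm :
    ContMDiffAt 𝓘(ℝ, E) 𝓘(ℝ, E) ∞ (chartAt E (1 : G)).symm (chartAt E (1 : G) 1) :=
  have : IsManifold 𝓘(ℝ, E) ∞ G := inferInstance
  contMDiffOn_chart_symm.contMDiffAt (chart_target_mem_nhds E (1 : G))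

theorem chartAt_one_symm_apply : (chartAt E (1 : G)).symm (chartAt E (1 : G) 1) = 1 := by simp

/-- The multiplication of a Lie group in the chart at the unit. -/
noncomputable def chartMul (E G : Type*) [NormedAddCommGroup E]
    [TopologicalSpace G] [ChartedSpace E G] [Group G] (q : E × E) : E :=
  chartAt E (1 : G) ((chartAt E (1 : G)).symm q.1 * (chartAt E (1 : G)).symm q.2)

theorem contDiffAt_chartMul :
    ContDiffAt ℝ ∞ (chartMul E G) (chartAt E (1 : G) 1, chartAt E (1 : G) 1) := by
  rw [← contMDiffAt_iff_contDiffAt]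
  have h1 : ContMDiffAt 𝓘(ℝ, E × E) 𝓘(ℝ, E) ∞
      (fun q : E × E => (chartAt E (1 : G)).symm q.1)
      (chartAt E (1 : G) 1, chartAt E (1 : G) 1) :=
    ContMDiffAt.comp _ contMDiffAt_chartAt_one_symm contDiff_fst.contMDiff.contMDiffAt
  have h2 : ContMDiffAt 𝓘(ℝ, E × E) 𝓘(ℝ, E) ∞
      (fun q : E × E => (chartAt E (1 : G)).symm q.2)
      (chartAt E (1 : G) 1, chartAt E (1 : G) 1) :=
    ContMDiffAt.comp _ contMDiffAt_chartAt_one_symm contDiff_snd.contMDiff.contMDiffAt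
  refine ContMDiffAt.comp_of_eq (g := chartAt E (1 : G)) contMDiffAt_chartAt_one
    (h1.mul h2) (by simp)

/-- The conjugation by `g` in the chart at the unit. -/
noncomputable def chartConj (E : Type*) [NormedAddCommGroup E] {G : Type*}
    [TopologicalSpace G] [ChartedSpace E G] [Group G] (g : G) (v : E) : E :=
  chartAt E (1 : G) (g * (chartAt E (1 : G)).symm v * g⁻¹)

theorem contDiffAt_chartConj (g : G) :
    ContDiffAt ℝ ∞ (chartConj E g) (chartAt E (1 : G) 1) := by
  rw [← contMDiffAt_iff_contDiffAt]
  refine ContMDiffAt.comp_of_eq (g := chartAt E (1 : G)) contMDiffAt_chartAt_one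
    ((contMDiffAt_const.mul contMDiffAt_chartAt_one_symm).mul contMDiffAt_const) (by simp)

/-- The adjoint representation, in the chart at the unit. -/
noncomputable def lieAd (E : Type*) [NormedAddCommGroup E] [NormedSpace ℝ E] {G : Type*}
    [TopologicalSpace G] [ChartedSpace E G] [Group G] (g : G) : E →L[ℝ] E :=
  fderiv ℝ (chartConj E g) (chartAt E (1 : G) 1)

/-- The curve `γ` has at time `t` the derivative `dl_{γ t} ξ`; this is written in the chart at
the unit for the curve `(γ t)⁻¹ * γ`. -/
structure HasVelocityAt (γ : ℝ → G) (ξ : E) (t : ℝ) : Prop where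
  continuousAt : ContinuousAt γ t
  hasDerivAt : HasDerivAt (fun r => chartAt E (1 : G) ((γ t)⁻¹ * γ r)) ξ t

theorem hasMFDerivAt_iff_of_eq_one {γ : ℝ → G} {t : ℝ} (h : γ t = 1) (ξ : E) :
    HasMFDerivAt 𝓘(ℝ, ℝ) 𝓘(ℝ, E) γ t ((1 : ℝ →L[ℝ] ℝ).smulRight ξ) ↔
      ContinuousAt γ t ∧ HasDerivAt (fun r => chartAt E (1 : G) (γ r)) ξ t := by
  rw [hasDerivAt_iff_hasFDerivAt]
  unfold HasMFDerivAt
  simp only [mfld_simps, h]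
  have h' : ContinuousLinearMap.toSpanSingleton ℝ ξ = (1 : ℝ →L[ℝ] ℝ).smulRight ξ := by ext; simp
  rw [h']
  exact and_congr_right fun _ => hasFDerivWithinAt_univ

theorem eventually_chartAt_one_symm_apply {γ : ℝ → G} {t : ℝ} (hγ : ContinuousAt γ t)
    (h : γ t = 1) : ∀ᶠ r in 𝓝 t, (chartAt E (1 : G)).symm (chartAt E (1 : G) (γ r)) = γ r := by
  have := hγ.eventually_mem (by rw [h]; exact chart_source_mem_nhds E (1 : G))
  filter_upwards [this] with r hr
  exact (chartAt E (1 : G)).left_inv hr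

theorem comp_one_smulRight {F : Type*} [NormedAddCommGroup F] [NormedSpace ℝ F]
    (L : E →L[ℝ] F) {ξ : E} {η : F} (h : L ξ = η) :
    L.comp ((1 : ℝ →L[ℝ] ℝ).smulRight ξ) = (1 : ℝ →L[ℝ] ℝ).smulRight η := by
  ext; simp [h]

theorem contMDiff_mul_left_top (g : G) : ContMDiff 𝓘(ℝ, E) 𝓘(ℝ, E) ∞ (g * ·) :=
  contMDiff_mul_left

theorem hasVelocityAt_iff {γ : ℝ → G} {t : ℝ} {ξ : E} :
    HasVelocityAt γ ξ t ↔ HasMFDerivAt 𝓘(ℝ, ℝ) 𝓘(ℝ, E) γ t ((1 : ℝ →L[ℝ] ℝ).smulRight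
      (mulInvariantVectorField (ξ : GroupLieAlgebra 𝓘(ℝ, E) G) (γ t))) := by
  have hmd : ∀ g h : G, MDifferentiableAt 𝓘(ℝ, E) 𝓘(ℝ, E) (g * ·) h := fun g h =>
    (contMDiff_mul_left_top g).mdifferentiable (by simp) h
  constructor
  · rintro ⟨h1, h2⟩
    have h3 : HasMFDerivAt 𝓘(ℝ, ℝ) 𝓘(ℝ, E) (fun r => (γ t)⁻¹ * γ r) t
        ((1 : ℝ →L[ℝ] ℝ).smulRight ξ) := by
      rw [hasMFDerivAt_iff_of_eq_one (by simp)]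
      exact ⟨(contMDiff_mul_left_top (E := E) _).continuous.continuousAt.comp h1, h2⟩
    have h4 : HasMFDerivAt 𝓘(ℝ, E) 𝓘(ℝ, E) (γ t * ·) ((γ t)⁻¹ * γ t)
        (mfderiv 𝓘(ℝ, E) 𝓘(ℝ, E) (γ t * ·) ((γ t)⁻¹ * γ t)) := (hmd _ _).hasMFDerivAt
    have h5 := h4.comp t h3
    have h6 : ((γ t * ·) ∘ fun r => (γ t)⁻¹ * γ r) = γ := by ext r; simp
    rw [h6] at h5
    refine h5.congr_mfderiv ?_
    -- The base point is kept variable because the tangent spaces depend on it; substitution then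
    -- identifies them.
    have h7 : ∀ x : G, x = 1 → (mfderiv 𝓘(ℝ, E) 𝓘(ℝ, E) (γ t * ·) x : E →L[ℝ] E) ξ =
        (mfderiv 𝓘(ℝ, E) 𝓘(ℝ, E) (γ t * ·) (1 : G) : E →L[ℝ] E) ξ := by
      rintro _ rfl; rfl
    have h8 := comp_one_smulRight (E := E) (F := E) _ (h7 ((γ t)⁻¹ * γ t) (by simp))
    exact h8
  · intro h
    refine ⟨h.continuousAt, ?_⟩
    have h4 : HasMFDerivAt 𝓘(ℝ, E) 𝓘(ℝ, E) ((γ t)⁻¹ * ·) (γ t)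
        (mfderiv 𝓘(ℝ, E) 𝓘(ℝ, E) ((γ t)⁻¹ * ·) (γ t)) := (hmd _ _).hasMFDerivAt
    have h5 := h4.comp t h
    have h6 := mfderiv_comp_apply (I' := 𝓘(ℝ, E)) (1 : G) (hmd (γ t)⁻¹ (γ t * 1)) (hmd (γ t) 1) ξ
    have h7 : ((γ t)⁻¹ * ·) ∘ (γ t * ·) = (id : G → G) := by ext; simp
    rw [h7, mfderiv_id] at h6
    have h8 : ∀ x : G, x = γ t → ∀ v : E,
        (mfderiv 𝓘(ℝ, E) 𝓘(ℝ, E) ((γ t)⁻¹ * ·) x : E →L[ℝ] E) v =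
        (mfderiv 𝓘(ℝ, E) 𝓘(ℝ, E) ((γ t)⁻¹ * ·) (γ t) : E →L[ℝ] E) v := by
      rintro _ rfl _; rfl
    refine ((hasMFDerivAt_iff_of_eq_one (E := E) (by simp) ξ).1 (h5.congr_mfderiv ?_)).2
    have h9 := h8 (γ t * 1) (by simp)
      ((mfderiv 𝓘(ℝ, E) 𝓘(ℝ, E) (γ t * ·) (1 : G) : E →L[ℝ] E) ξ)
    have h10 := comp_one_smulRight (E := E) (F := E) _ (h9.symm.trans h6.symm)
    exact h10

theorem HasVelocityAt.unique {γ : ℝ → G} {ξ η : E} {t : ℝ} (h : HasVelocityAt γ ξ t)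
    (h' : HasVelocityAt γ η t) : ξ = η := h.hasDerivAt.unique h'.hasDerivAt

theorem HasVelocityAt.of_eq_one {γ : ℝ → G} {ξ : E} {t : ℝ} (h : γ t = 1)
    (hc : ContinuousAt γ t) (hd : HasDerivAt (fun r => chartAt E (1 : G) (γ r)) ξ t) :
    HasVelocityAt γ ξ t := ⟨hc, by simpa [h] using hd⟩

theorem HasVelocityAt.hasDerivAt_of_eq_one {γ : ℝ → G} {ξ : E} {t : ℝ} (h : γ t = 1)
    (hγ : HasVelocityAt γ ξ t) : HasDerivAt (fun r => chartAt E (1 : G) (γ r)) ξ t := by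
  simpa [h] using hγ.hasDerivAt

theorem HasVelocityAt.const_mul {γ : ℝ → G} {ξ : E} {t : ℝ} (hγ : HasVelocityAt γ ξ t) (g : G) :
    HasVelocityAt (fun r => g * γ r) ξ t :=
  ⟨(contMDiff_mul_left_top (E := E) g).continuous.continuousAt.comp (f := γ) hγ.continuousAt, by
    simpa [mul_assoc] using hγ.hasDerivAt⟩

theorem HasVelocityAt.comp {γ : ℝ → G} {ξ : E} {f : ℝ → ℝ} {f' t : ℝ}
    (hγ : HasVelocityAt γ ξ (f t)) (hf : HasDerivAt f f' t) :
    HasVelocityAt (fun r => γ (f r)) (f' • ξ) t :=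
  ⟨ContinuousAt.comp hγ.continuousAt hf.continuousAt, hγ.hasDerivAt.scomp t hf⟩

theorem HasVelocityAt.conj_of_eq_one {γ : ℝ → G} {ξ : E} {t : ℝ} (h : γ t = 1)
    (hγ : HasVelocityAt γ ξ t) (g : G) :
    HasVelocityAt (fun r => g * γ r * g⁻¹) (lieAd E g ξ) t := by
  have : IsTopologicalGroup G := topologicalGroup_of_lieGroup 𝓘(ℝ, E) ∞
  have hc := hγ.continuousAt
  refine .of_eq_one (by simp [h]) (by fun_prop) ?_
  have h1 : HasFDerivAt (chartConj E g) (lieAd E g) (chartAt E (1 : G) (γ t)) := by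
    rw [h]
    exact ((contDiffAt_chartConj g).differentiableAt (by simp)).hasFDerivAt
  have h2 := h1.comp_hasDerivAt t (hγ.hasDerivAt_of_eq_one h)
  refine h2.congr_of_eventuallyEq ?_
  filter_upwards [eventually_chartAt_one_symm_apply (E := E) hc h] with r hr
  simp [chartConj, hr]

/-- The unit is neutral on both sides, so each partial derivative of the multiplication there is the
identity. -/
theorem fderiv_chartMul_apply (v w : E) :
    fderiv ℝ (chartMul E G) (chartAt E (1 : G) 1, chartAt E (1 : G) 1) (v, w) = v + w := by
  set p := chartAt E (1 : G) 1 with hp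
  have h := ((contDiffAt_chartMul (E := E) (G := G)).differentiableAt (by simp)).hasFDerivAt
  have hm := (chart_target_mem_nhds E (1 : G))
  have h1 : HasFDerivAt (fun x : E => chartMul E G (x, p)) (.id ℝ E) p := by
    refine (hasFDerivAt_id p).congr_of_eventuallyEq ?_
    filter_upwards [hm] with x hx
    simp [chartMul, hp, (chartAt E (1 : G)).right_inv hx]
  have h2 : HasFDerivAt (fun x : E => chartMul E G (p, x)) (.id ℝ E) p := by
    refine (hasFDerivAt_id p).congr_of_eventuallyEq ?_
    filter_upwards [hm] with x hx
    simp [chartMul, hp, (chartAt E (1 : G)).right_inv hx]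
  have h1' := h1.unique (h.comp (f := fun x => (x, p)) p ((hasFDerivAt_id p).prodMk (hasFDerivAt_const p p)))
  have h2' := h2.unique (h.comp (f := fun x => (p, x)) p ((hasFDerivAt_const p p).prodMk (hasFDerivAt_id p)))
  have e1 := congrArg (fun L => L v) h1'
  have e2 := congrArg (fun L => L w) h2'
  simp at e1 e2
  rw [show (v, w) = (v, 0) + (0, w) by simp, map_add, ← e1, ← e2]

theorem HasVelocityAt.mul_of_eq_one {γ δ : ℝ → G} {ξ η : E} {t : ℝ} (h : γ t = 1) (h' : δ t = 1)
    (hγ : HasVelocityAt γ ξ t) (hδ : HasVelocityAt δ η t) :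
    HasVelocityAt (fun r => γ r * δ r) (ξ + η) t := by
  have : IsTopologicalGroup G := topologicalGroup_of_lieGroup 𝓘(ℝ, E) ∞
  have hc := hγ.continuousAt
  have hc' := hδ.continuousAt
  refine .of_eq_one (by simp [h, h']) (by fun_prop) ?_
  have h1 := ((contDiffAt_chartMul (E := E) (G := G)).differentiableAt (by simp)).hasFDerivAt
  have h3 := (hγ.hasDerivAt_of_eq_one h).prodMk (hδ.hasDerivAt_of_eq_one h')
  have h2 := h1.comp_hasDerivAt_of_eq t h3 (by simp [h, h'])
  rw [fderiv_chartMul_apply] at h2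
  refine h2.congr_of_eventuallyEq ?_
  filter_upwards [eventually_chartAt_one_symm_apply (E := E) hc h, eventually_chartAt_one_symm_apply (E := E) hc' h']
    with r hr hr'
  simp [chartMul, hr, hr']

/-- With `g = γ t` and `h = δ t`, one has `γ δ = g h · (h⁻¹ (g⁻¹ γ) h) · (h⁻¹ δ)`. The last two
factors pass through the unit at time `t`, where velocities simply add. -/
theorem HasVelocityAt.mul {γ δ : ℝ → G} {ξ η : E} {t : ℝ}
    (hγ : HasVelocityAt γ ξ t) (hδ : HasVelocityAt δ η t) :
    HasVelocityAt (fun r => γ r * δ r) (lieAd E (δ t)⁻¹ ξ + η) t := by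
  have h1 := (hγ.const_mul (γ t)⁻¹).conj_of_eq_one (by simp) (δ t)⁻¹
  have h2 := (h1.mul_of_eq_one (by simp) (by simp) (hδ.const_mul (δ t)⁻¹)).const_mul (γ t * δ t)
  simpa [mul_assoc] using h2

end LieGroupChart

/-! ### One-parameter subgroups and the adjoint representation -/

section LieExp

set_option linter.unusedSectionVars false

variable {E : Type*} [NormedAddCommGroup E] [NormedSpace ℝ E]
  {G : Type*} [TopologicalSpace G] [ChartedSpace E G] [Group G] [LieGroup 𝓘(ℝ, E) ∞ G]

theorem isMIntegralCurve_mulInvariantVectorField_iff {γ : ℝ → G}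
    {X : GroupLieAlgebra 𝓘(ℝ, E) G} :
    IsMIntegralCurve (I := 𝓘(ℝ, E)) γ (mulInvariantVectorField X) ↔
      ∀ t, HasVelocityAt (E := E) γ X t :=
  forall_congr' fun _ => hasVelocityAt_iff.symm

theorem contMDiff_one_mulInvariantVectorField (X : GroupLieAlgebra 𝓘(ℝ, E) G) :
    ContMDiff 𝓘(ℝ, E) 𝓘(ℝ, E).tangent 1
      (fun g : G => (mulInvariantVectorField X g : TangentBundle 𝓘(ℝ, E) G)) := by
  have := lieGroup_minSmoothness_three E G
  refine (contMDiff_mulInvariantVectorField X).of_le ?_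
  rw [minSmoothness_of_isRCLikeNormedField]
  exact one_le_two

theorem eq_of_hasVelocityAt_const [T2Space G] {γ δ : ℝ → G} {X : E}
    (hγ : ∀ t, HasVelocityAt γ X t) (hδ : ∀ t, HasVelocityAt δ X t) {t₀ : ℝ} (h : γ t₀ = δ t₀) :
    γ = δ :=
  isMIntegralCurve_Ioo_eq_of_contMDiff_boundaryless
    (contMDiff_one_mulInvariantVectorField (E := E) (G := G) X)
    ((isMIntegralCurve_mulInvariantVectorField_iff (E := E) (X := X)).2 hγ)
    ((isMIntegralCurve_mulInvariantVectorField_iff (E := E) (X := X)).2 hδ) h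

variable [CompleteSpace E] [T2Space G]

/-- Left translates of one local integral curve give the same existence time at every point, so the
solution extends to all of `ℝ`. -/
theorem exists_hasVelocityAt_const (X : E) :
    ∃ γ : ℝ → G, γ 0 = 1 ∧ ∀ t, HasVelocityAt γ X t := by
  have hv := contMDiff_one_mulInvariantVectorField (E := E) (G := G) X
  obtain ⟨γ, h0, hγ⟩ := exists_isMIntegralCurveAt_of_contMDiffAt_boundaryless 0
    (hv.contMDiffAt (x := (1 : G)))
  obtain ⟨ε, hε, hγ⟩ := Metric.eventually_nhds_iff_ball.1 hγ
  rw [Real.ball_eq_Ioo, zero_sub, zero_add] at hγ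
  have h : ∀ x : G, ∃ γ : ℝ → G, γ 0 = x ∧ IsMIntegralCurveOn (I := 𝓘(ℝ, E)) γ
      (mulInvariantVectorField (I := 𝓘(ℝ, E)) (G := G) X) (Ioo (-ε) ε) := fun x =>
    ⟨fun t => x * γ t, by simp [h0], fun t ht =>
      (hasVelocityAt_iff.1 ((hasVelocityAt_iff.2 (hγ t ht)).const_mul x)).hasMFDerivWithinAt⟩
  obtain ⟨γ, h0, hγ⟩ := exists_isMIntegralCurve_of_isMIntegralCurveOn hv hε h 1
  exact ⟨γ, h0, (isMIntegralCurve_mulInvariantVectorField_iff (E := E) (X := X)).1 hγ⟩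

/-- The one-parameter subgroup `t ↦ exp (t X)` with generator `X`, an element of the tangent space
at the unit. -/
noncomputable def oneParam (X : E) (t : ℝ) : G :=
  let Y : GroupLieAlgebra 𝓘(ℝ, E) G := X
  lieExp (t • Y)

theorem oneParam_eq {γ : ℝ → G} {X : E} (h0 : γ 0 = 1)
    (hγ : ∀ t, HasVelocityAt γ X t) : oneParam X = γ := by
  funext t
  -- Rescaling time turns an integral curve of `X` into one of `t X`, whose value at time `1` is `γ
  -- t`.
  have h1 : ∀ r, HasVelocityAt (fun r => γ (r * t)) (t • X) r :=
    fun r => (hγ (r * t)).comp (f := fun r => r * t) (by simpa using (hasDerivAt_id r).mul_const t)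
  have h : ∃ δ : ℝ → G, δ 0 = 1 ∧ IsMIntegralCurve (I := 𝓘(ℝ, E)) δ
      (mulInvariantVectorField (I := 𝓘(ℝ, E)) (G := G) (t • X)) :=
    ⟨_, by simpa using h0,
      (isMIntegralCurve_mulInvariantVectorField_iff (E := E) (X := t • X)).2 h1⟩
  have h2 : (oneParam X t : G) = h.choose 1 := dif_pos h
  rw [h2]
  have := eq_of_hasVelocityAt_const
    ((isMIntegralCurve_mulInvariantVectorField_iff (E := E) (X := t • X)).1 h.choose_spec.2) h1
    (t₀ := 0) (by simp [h.choose_spec.1, h0])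
  simpa using congrFun this 1

theorem hasVelocityAt_oneParam (X : E) (t : ℝ) : HasVelocityAt (oneParam (G := G) X) X t := by
  obtain ⟨γ, h0, hγ⟩ := exists_hasVelocityAt_const (G := G) X
  simpa only [oneParam_eq h0 hγ] using hγ t

theorem oneParam_zero (X : E) : (oneParam X 0 : G) = 1 := by
  obtain ⟨γ, h0, hγ⟩ := exists_hasVelocityAt_const (G := G) X
  rw [oneParam_eq h0 hγ, h0]

theorem oneParam_add (X : E) (r t : ℝ) :
    (oneParam X (r + t) : G) = oneParam X r * oneParam X t := by
  have h : (fun t : ℝ => (oneParam X (r + t) : G)) = fun t => oneParam X r * oneParam X t := by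
    refine eq_of_hasVelocityAt_const (X := X) (t₀ := 0) (fun t => ?_)
      (fun t => (hasVelocityAt_oneParam X t).const_mul _) ?_
    · simpa using (hasVelocityAt_oneParam X (r + t)).comp ((hasDerivAt_id t).const_add r)
    · simp [oneParam_zero]
  exact congrFun h t

theorem oneParam_neg (X : E) (t : ℝ) : (oneParam X (-t) : G) = (oneParam X t)⁻¹ := by
  refine eq_inv_of_mul_eq_one_left ?_
  rw [← oneParam_add, neg_add_cancel, oneParam_zero]

theorem conj_oneParam (g : G) (X : E) (t : ℝ) :
    g * oneParam X t * g⁻¹ = oneParam (lieAd E g X) t := by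
  refine (congrFun (oneParam_eq (γ := fun t : ℝ => g * oneParam X t * g⁻¹) (by simp [oneParam_zero])
    (fun t => ?_)) t).symm
  have h0 : HasVelocityAt (fun _ : ℝ => g⁻¹) (0 : E) t :=
    ⟨continuousAt_const, hasDerivAt_const _ _⟩
  simpa [mul_assoc] using! ((hasVelocityAt_oneParam X t).mul h0).const_mul g

/-- Characterizes `lieAd E g X` as a velocity; by uniqueness of velocities `lieAd` is then
multiplicative in `g`. -/
theorem hasVelocityAt_conj_oneParam (g : G) (X : E) :
    HasVelocityAt (fun t : ℝ => g * oneParam X t * g⁻¹) (lieAd E g X) 0 :=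
  (hasVelocityAt_oneParam X 0).conj_of_eq_one (oneParam_zero _) g

theorem lieAd_mul (g h : G) (X : E) : lieAd E (g * h) X = lieAd E g (lieAd E h X) := by
  refine (hasVelocityAt_conj_oneParam (g * h) X).unique ?_
  have := (hasVelocityAt_conj_oneParam h X).conj_of_eq_one (by simp [oneParam_zero]) g
  simpa [mul_assoc] using this

theorem lieAd_one (X : E) : lieAd E (1 : G) X = X := by
  refine (hasVelocityAt_conj_oneParam (1 : G) X).unique ?_
  simpa using! hasVelocityAt_oneParam (G := G) X 0

end LieExp

/-! ### Second-order expansion of the multiplication and the derivative of `Ad` -/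

section ChartMulDerivatives

variable {E : Type*} [NormedAddCommGroup E] [NormedSpace ℝ E]
  {G : Type*} [TopologicalSpace G] [ChartedSpace E G] [Group G] [LieGroup 𝓘(ℝ, E) ∞ G]

/-- The derivative of `chartMul` in its second variable, at the unit. -/
noncomputable def chartMulRight (E G : Type*) [NormedAddCommGroup E] [NormedSpace ℝ E]
    [TopologicalSpace G] [ChartedSpace E G] [Group G] (v : E) : E →L[ℝ] E :=
  (fderiv ℝ (chartMul E G) (v, chartAt E (1 : G) 1)).comp (.inr ℝ E E)

/-- The derivative of `chartMul` in its first variable, at the unit. -/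
noncomputable def chartMulLeft (E G : Type*) [NormedAddCommGroup E] [NormedSpace ℝ E]
    [TopologicalSpace G] [ChartedSpace E G] [Group G] (v : E) : E →L[ℝ] E :=
  (fderiv ℝ (chartMul E G) (chartAt E (1 : G) 1, v)).comp (.inl ℝ E E)

theorem differentiableAt_fderiv_chartMul :
    DifferentiableAt ℝ (fderiv ℝ (chartMul E G)) (chartAt E (1 : G) 1, chartAt E (1 : G) 1) :=
  ((contDiffAt_chartMul (E := E) (G := G)).fderiv_right (m := 1)
    (WithTop.coe_le_coe.2 le_top)).differentiableAt (by simp)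

/-- The second derivative of `chartMul` at the unit. -/
noncomputable abbrev chartMulSnd (E G : Type*) [NormedAddCommGroup E] [NormedSpace ℝ E]
    [TopologicalSpace G] [ChartedSpace E G] [Group G] : E × E →L[ℝ] E × E →L[ℝ] E :=
  fderiv ℝ (fderiv ℝ (chartMul E G)) (chartAt E (1 : G) 1, chartAt E (1 : G) 1)

theorem chartMulSnd_symm (q r : E × E) : chartMulSnd E G q r = chartMulSnd E G r q := by
  refine (contDiffAt_chartMul (E := E) (G := G)).isSymmSndFDerivAt ?_ q r
  rw [minSmoothness_of_isRCLikeNormedField]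
  exact WithTop.coe_le_coe.2 le_top

theorem hasFDerivAt_chartMulRight_apply (y : E) :
    HasFDerivAt (fun v => chartMulRight E G v y)
      (((ContinuousLinearMap.apply ℝ E ((0, y) : E × E)).comp (chartMulSnd E G)).comp (.inl ℝ E E))
      (chartAt E (1 : G) 1) := by
  have h1 := (differentiableAt_fderiv_chartMul (E := E) (G := G)).hasFDerivAt
  have h2 := h1.comp (f := fun x => (x, chartAt E (1 : G) 1)) _
    ((hasFDerivAt_id (𝕜 := ℝ) _).prodMk (hasFDerivAt_const _ _))
  have h3 := h2.clm_apply (hasFDerivAt_const ((0, y) : E × E) _)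
  convert! h3 using 1
  ext x; simp

theorem differentiableAt_chartMulLeft :
    DifferentiableAt ℝ (chartMulLeft E G) (chartAt E (1 : G) 1) := by
  have h1 := (differentiableAt_fderiv_chartMul (E := E) (G := G))
  have h2 : DifferentiableAt ℝ (fun v => fderiv ℝ (chartMul E G) (chartAt E (1 : G) 1, v))
      (chartAt E (1 : G) 1) :=
    h1.comp (f := fun x => (chartAt E (1 : G) 1, x)) _ (by fun_prop)
  exact h2.clm_comp (differentiableAt_const _)

theorem hasFDerivAt_chartMulLeft_apply (y : E) :
    HasFDerivAt (fun v => chartMulLeft E G v y)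
      (((ContinuousLinearMap.apply ℝ E ((y, 0) : E × E)).comp (chartMulSnd E G)).comp (.inr ℝ E E))
      (chartAt E (1 : G) 1) := by
  have h1 := (differentiableAt_fderiv_chartMul (E := E) (G := G)).hasFDerivAt
  have h2 := h1.comp (f := fun x => (chartAt E (1 : G) 1, x)) _
    ((hasFDerivAt_const _ _).prodMk (hasFDerivAt_id (𝕜 := ℝ) _))
  have h3 := h2.clm_apply (hasFDerivAt_const ((y, 0) : E × E) _)
  convert! h3 using 1
  ext x; simp

theorem chartMulLeft_one (y : E) : chartMulLeft E G (chartAt E (1 : G) 1) y = y := by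
  simp [chartMulLeft, fderiv_chartMul_apply]

theorem chartMulRight_one (y : E) : chartMulRight E G (chartAt E (1 : G) 1) y = y := by
  simp [chartMulRight, fderiv_chartMul_apply]

theorem eventually_differentiableAt_chartMul :
    ∀ᶠ q in 𝓝 (chartAt E (1 : G) 1, chartAt E (1 : G) 1), DifferentiableAt ℝ (chartMul E G) q := by
  have h := ((contDiffAt_chartMul (E := E) (G := G)).of_le (m := 1)
    (WithTop.coe_le_coe.2 le_top)).eventually (by simp)
  filter_upwards [h] with q hq using hq.differentiableAt (by simp)

theorem eventually_hasDerivAt_chart_mul_right [CompleteSpace E] [T2Space G] :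
    ∀ᶠ v in 𝓝 (chartAt E (1 : G) 1), ∀ X : E,
      HasDerivAt (fun t : ℝ => chartAt E (1 : G) ((chartAt E (1 : G)).symm v * oneParam X t))
        (chartMulRight E G v X) 0 := by
  have h : Tendsto (fun v => (v, chartAt E (1 : G) 1)) (𝓝 (chartAt E (1 : G) 1))
    (𝓝 (chartAt E (1 : G) 1, chartAt E (1 : G) 1)) := (Continuous.prodMk_left _).tendsto _
  filter_upwards [h.eventually eventually_differentiableAt_chartMul] with v hv X
  have h0 := (hasVelocityAt_oneParam (G := G) X 0)
  have h1 := hv.hasFDerivAt.comp_hasDerivAt_of_eq (0 : ℝ) ((hasDerivAt_const _ v).prodMk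
    (h0.hasDerivAt_of_eq_one (oneParam_zero X))) (by simp [oneParam_zero])
  refine h1.congr_of_eventuallyEq ?_
  filter_upwards [eventually_chartAt_one_symm_apply (E := E) h0.continuousAt (oneParam_zero X)]
    with r hr
  simp [chartMul, hr]

theorem eventually_hasDerivAt_chart_mul_left [CompleteSpace E] [T2Space G] :
    ∀ᶠ v in 𝓝 (chartAt E (1 : G) 1), ∀ X : E,
      HasDerivAt (fun t : ℝ => chartAt E (1 : G) (oneParam X t * (chartAt E (1 : G)).symm v))
        (chartMulLeft E G v X) 0 := by
  have h : Tendsto (fun v => (chartAt E (1 : G) 1, v)) (𝓝 (chartAt E (1 : G) 1))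
    (𝓝 (chartAt E (1 : G) 1, chartAt E (1 : G) 1)) := (Continuous.prodMk_right _).tendsto _
  filter_upwards [h.eventually eventually_differentiableAt_chartMul] with v hv X
  have h0 := (hasVelocityAt_oneParam (G := G) X 0)
  have h1 := hv.hasFDerivAt.comp_hasDerivAt_of_eq (0 : ℝ) (
    (h0.hasDerivAt_of_eq_one (oneParam_zero X)).prodMk (hasDerivAt_const _ v))
    (by simp [oneParam_zero])
  refine h1.congr_of_eventuallyEq ?_
  filter_upwards [eventually_chartAt_one_symm_apply (E := E) h0.continuousAt (oneParam_zero X)]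
    with r hr
  simp [chartMul, hr]

/-- This is the derivative at `t = 0` of `exp (t Ad_g X) g = g exp (t X)`. It expresses `Ad` through
derivatives of the multiplication. -/
theorem eventually_chartMulLeft_lieAd [CompleteSpace E] [T2Space G] :
    ∀ᶠ v in 𝓝 (chartAt E (1 : G) 1), ∀ X : E,
      chartMulLeft E G v (lieAd E ((chartAt E (1 : G)).symm v) X) = chartMulRight E G v X := by
  filter_upwards [eventually_hasDerivAt_chart_mul_left (E := E) (G := G),
    eventually_hasDerivAt_chart_mul_right (E := E) (G := G)] with v h1 h2 X
  refine (h1 _).unique ?_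
  convert! h2 X using 3 with t
  rw [← conj_oneParam]
  simp

/-- The derivative at `0` of `Ad (exp (t X)) Y`, in the chart at the unit. -/
theorem hasDerivAt_lieAd_oneParam_zero [CompleteSpace E] [T2Space G] (X Y : E) :
    HasDerivAt (fun t => lieAd E (oneParam X t : G) Y)
      (chartMulSnd E G (X, 0) (0, Y) - chartMulSnd E G (Y, 0) (0, X)) 0 := by
  set p := chartAt E (1 : G) 1 with hp
  have h0 := hasVelocityAt_oneParam (G := G) X 0
  set β : ℝ → E := fun t => chartAt E (1 : G) (oneParam X t) with hβ
  have hβ0 : β 0 = p := by simp [hβ, oneParam_zero, hp]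
  have hd : HasDerivAt β X 0 := h0.hasDerivAt_of_eq_one (oneParam_zero X)
  have ht : Tendsto β (𝓝 0) (𝓝 p) := hβ0 ▸ hd.continuousAt.tendsto
  have hsym := eventually_chartAt_one_symm_apply (E := E) h0.continuousAt (oneParam_zero X)
  have hA : DifferentiableAt ℝ (fun t => chartMulLeft E G (β t)) 0 :=
    DifferentiableAt.comp (g := chartMulLeft E G) (0 : ℝ)
      (by rw [hβ0]; exact differentiableAt_chartMulLeft) hd.differentiableAt
  have hA0 : chartMulLeft E G (β 0) = ContinuousLinearMap.id ℝ E := by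
    ext y; rw [hβ0]; exact chartMulLeft_one y
  have hB : HasDerivAt (fun t => chartMulRight E G (β t) Y) (chartMulSnd E G (X, 0) (0, Y)) 0 := by
    have := (hasFDerivAt_chartMulRight_apply (G := G) Y).comp_hasDerivAt_of_eq (0 : ℝ) hd hβ0.symm
    simpa using! this
  set c : ℝ → E := fun t => lieAd E (oneParam X t : G) Y with hc
  have hrel : ∀ᶠ t in 𝓝 (0 : ℝ), chartMulLeft E G (β t) (c t) = chartMulRight E G (β t) Y := by
    filter_upwards [ht.eventually eventually_chartMulLeft_lieAd, hsym] with t h1 h2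
    have := h1 Y
    rwa [h2] at this
  have hinv : ∀ᶠ t in 𝓝 (0 : ℝ), (chartMulLeft E G (β t)).IsInvertible := by
    have h1 : range ((↑) : (E ≃L[ℝ] E) → E →L[ℝ] E) ∈ 𝓝 (chartMulLeft E G (β 0)) := by
      rw [hA0]; exact ContinuousLinearEquiv.nhds (.refl ℝ E)
    filter_upwards [hA.continuousAt.eventually h1] with t ht'
    exact ht'
  -- Near `t = 0` the left factor in `hrel` is close to the identity, hence invertible, and
  -- inversion of operators is differentiable; so `hrel` can be solved for `c`.
  have hcd : DifferentiableAt ℝ c 0 := by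
    have h1 : DifferentiableAt ℝ (fun t => (chartMulLeft E G (β t)).inverse) 0 := by
      refine DifferentiableAt.comp (0 : ℝ) (g := ContinuousLinearMap.inverse) ?_ hA
      rw [hA0]
      exact (contDiffAt_map_inverse (n := 1) (.refl ℝ E)).differentiableAt (by simp)
    refine (h1.clm_apply hB.differentiableAt).congr_of_eventuallyEq ?_
    filter_upwards [hrel, hinv] with t h1 h2
    rw [← h1, h2.inverse_apply_self]
  have hc0 : c 0 = Y := by simp [hc, oneParam_zero, lieAd_one]
  -- The product rule applied to `hrel` at `0` yields `A' Y + c' = B'`, where `A'` and `B'` are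
  -- mixed second derivatives of the multiplication.
  have h1 := hA.hasDerivAt.clm_apply hcd.hasDerivAt
  have h2 : HasDerivAt (fun t => chartMulLeft E G (β t) Y) (chartMulSnd E G (0, X) (Y, 0)) 0 := by
    have := (hasFDerivAt_chartMulLeft_apply (G := G) Y).comp_hasDerivAt_of_eq (0 : ℝ) hd hβ0.symm
    simpa using! this
  have h3 := (hA.hasDerivAt.clm_apply (hasDerivAt_const 0 Y)).unique h2
  have h4 := h1.unique (hB.congr_of_eventuallyEq hrel)
  simp only [hc0, hA0, map_zero, add_zero] at h3 h4
  have h5 : deriv c 0 = chartMulSnd E G (X, 0) (0, Y) - chartMulSnd E G (Y, 0) (0, X) := by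
    rw [chartMulSnd_symm (Y, 0), ← h3, ← h4]; simp
  rw [← h5]
  exact hcd.hasDerivAt

end ChartMulDerivatives

/-! ### The Lie bracket as the derivative of `Ad` -/

section AdjointDerivative

set_option linter.unusedSectionVars false

variable {E : Type*} [NormedAddCommGroup E] [NormedSpace ℝ E]
  {G : Type*} [TopologicalSpace G] [ChartedSpace E G] [Group G] [LieGroup 𝓘(ℝ, E) ∞ G]
  [CompleteSpace E] [T2Space G]

theorem eventually_mfderiv_extChartAt_mulInvariantVectorField :
    ∀ᶠ v in 𝓝 (chartAt E (1 : G) 1), ∀ X : E,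
      (mfderiv 𝓘(ℝ, E) 𝓘(ℝ, E) (extChartAt 𝓘(ℝ, E) (1 : G)) ((chartAt E (1 : G)).symm v) :
        E →L[ℝ] E) (mulInvariantVectorField (I := 𝓘(ℝ, E)) (G := G) X
          ((chartAt E (1 : G)).symm v)) = chartMulRight E G v X := by
  filter_upwards [eventually_hasDerivAt_chart_mul_right (E := E) (G := G),
    chart_target_mem_nhds E (1 : G)] with v h hv X
  set g := (chartAt E (1 : G)).symm v with hg
  have hgs : g ∈ (chartAt E (1 : G)).source := (chartAt E (1 : G)).map_target hv
  have h1 := (hasVelocityAt_iff (G := G)).1 ((hasVelocityAt_oneParam (G := G) X 0).const_mul g)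
  have h2 : HasMFDerivAt 𝓘(ℝ, E) 𝓘(ℝ, E) (extChartAt 𝓘(ℝ, E) (1 : G)) (g * oneParam X 0)
      (mfderiv 𝓘(ℝ, E) 𝓘(ℝ, E) (extChartAt 𝓘(ℝ, E) (1 : G)) (g * oneParam X 0)) :=
    (mdifferentiableAt_extChartAt (I := 𝓘(ℝ, E)) (by simpa [oneParam_zero] using hgs)).hasMFDerivAt
  have h3 := (h2.comp (0 : ℝ) h1).hasFDerivAt
  have h4 := (h X).hasFDerivAt.unique h3
  have h5 := congrArg (fun L : ℝ →L[ℝ] E => L 1) h4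
  have h6 : ∀ x : G, x = g →
      (mfderiv 𝓘(ℝ, E) 𝓘(ℝ, E) (extChartAt 𝓘(ℝ, E) (1 : G)) x : E →L[ℝ] E)
        (mulInvariantVectorField (I := 𝓘(ℝ, E)) (G := G) X x) =
      (mfderiv 𝓘(ℝ, E) 𝓘(ℝ, E) (extChartAt 𝓘(ℝ, E) (1 : G)) g : E →L[ℝ] E)
        (mulInvariantVectorField (I := 𝓘(ℝ, E)) (G := G) X g) := by
    rintro _ rfl; rfl
  rw [← h6 (g * oneParam X 0) (by simp [oneParam_zero])]
  have h7 := comp_one_smulRight (E := E) (F := E) (mfderiv 𝓘(ℝ, E) 𝓘(ℝ, E)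
    (extChartAt 𝓘(ℝ, E) (1 : G)) (g * oneParam X 0) : E →L[ℝ] E)
    (ξ := mulInvariantVectorField (I := 𝓘(ℝ, E)) (G := G) X (g * oneParam X 0)) rfl
  have h8 := congrArg (fun L : ℝ →L[ℝ] E => L 1) h7
  have h9 := h5.trans h8
  simp at h9
  exact h9.symm

open VectorField in
/-- A left-invariant vector field in the chart at the unit. -/
theorem eventually_mpullbackWithin_mulInvariantVectorField :
    ∀ᶠ v in 𝓝 (chartAt E (1 : G) 1), ∀ X : E,
      (mpullbackWithin 𝓘(ℝ, E) 𝓘(ℝ, E) (extChartAt 𝓘(ℝ, E) (1 : G)).symm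
        (mulInvariantVectorField (I := 𝓘(ℝ, E)) (G := G) X) (range 𝓘(ℝ, E)) v : E) =
      chartMulRight E G v X := by
  filter_upwards [eventually_mfderiv_extChartAt_mulInvariantVectorField (E := E) (G := G),
    chart_target_mem_nhds E (1 : G)] with v h hv X
  have hv' : v ∈ (extChartAt 𝓘(ℝ, E) (1 : G)).target := by simpa [mfld_simps] using hv
  have hi := ContinuousLinearMap.inverse_eq
    (mfderivWithin_extChartAt_symm_comp_mfderiv_extChartAt (I := 𝓘(ℝ, E)) (x := (1 : G)) hv')
    (mfderiv_extChartAt_comp_mfderivWithin_extChartAt_symm (I := 𝓘(ℝ, E)) (x := (1 : G)) hv')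
  rw [mpullbackWithin_apply, hi]
  exact h X

theorem mulInvariantVectorField_one (X : E) :
    (mulInvariantVectorField (I := 𝓘(ℝ, E)) (G := G) X 1 : E) = X := by
  have h : ∀ f : G → G, f = id → (mfderiv 𝓘(ℝ, E) 𝓘(ℝ, E) f (1 : G) : E →L[ℝ] E) X = X := by
    rintro _ rfl
    exact congrArg (fun L : E →L[ℝ] E => L X) (mfderiv_id (I := 𝓘(ℝ, E)) (x := (1 : G)))
  exact h _ (by ext; simp)

theorem mfderiv_extChartAt_one_apply (X : E) :
    (mfderiv 𝓘(ℝ, E) 𝓘(ℝ, E) (extChartAt 𝓘(ℝ, E) (1 : G)) 1 : E →L[ℝ] E) X = X := by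
  have h := (eventually_mfderiv_extChartAt_mulInvariantVectorField (E := E)
    (G := G)).self_of_nhds X
  have h6 : ∀ x : G, x = 1 →
    (mfderiv 𝓘(ℝ, E) 𝓘(ℝ, E) (extChartAt 𝓘(ℝ, E) (1 : G)) x : E →L[ℝ] E)
      (mulInvariantVectorField (I := 𝓘(ℝ, E)) (G := G) X x) =
    (mfderiv 𝓘(ℝ, E) 𝓘(ℝ, E) (extChartAt 𝓘(ℝ, E) (1 : G)) 1 : E →L[ℝ] E) X := by
    rintro _ rfl
    exact congrArg _ (mulInvariantVectorField_one X)
  exact (h6 _ chartAt_one_symm_apply).symm.trans (h.trans (chartMulRight_one (G := G) X))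

open VectorField in
-- In a vector space the bracket is `DW · V - DV · W`, and the derivatives of `chartMulRight` at the
-- unit are second derivatives of the multiplication. `V`, `W`, `L`, `s` stand for the ingredients
-- of the bracket on the manifold read in the chart.
theorem inverse_lieBracketWithin_chartMulRight {V W : E → E} {L : E →L[ℝ] E} {s : Set E} {X Y : E}
    (hV : ∀ᶠ v in 𝓝 (chartAt E (1 : G) 1), V v = chartMulRight E G v X)
    (hW : ∀ᶠ v in 𝓝 (chartAt E (1 : G) 1), W v = chartMulRight E G v Y)
    (hL : ∀ x, L x = x) (hs : s = univ) :
    L.inverse (lieBracketWithin ℝ V W s (chartAt E (1 : G) 1)) =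
      chartMulSnd E G (X, 0) (0, Y) - chartMulSnd E G (Y, 0) (0, X) := by
  have e1 := (hasFDerivAt_chartMulRight_apply (G := G) X).congr_of_eventuallyEq hV
  have e2 := (hasFDerivAt_chartMulRight_apply (G := G) Y).congr_of_eventuallyEq hW
  obtain rfl : L = ContinuousLinearMap.id ℝ E := ContinuousLinearMap.ext hL
  rw [hs, ContinuousLinearMap.inverse_id, lieBracketWithin_univ, lieBracket, e1.fderiv, e2.fderiv,
    hV.self_of_nhds, hW.self_of_nhds, chartMulRight_one, chartMulRight_one]
  simp

/-- The right side is exactly the derivative found in `hasDerivAt_lieAd_oneParam_zero`, which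
identifies that derivative with the bracket. -/
theorem bracket_eq_chartMulSnd (X Y : E) :
    (Bracket.bracket (L := GroupLieAlgebra 𝓘(ℝ, E) G) (M := GroupLieAlgebra 𝓘(ℝ, E) G) X Y : E) =
      chartMulSnd E G (X, 0) (0, Y) - chartMulSnd E G (Y, 0) (0, X) := by
  have h1 := eventually_mpullbackWithin_mulInvariantVectorField (E := E) (G := G)
  exact inverse_lieBracketWithin_chartMulRight
    (s := (extChartAt 𝓘(ℝ, E) (1 : G)).symm ⁻¹' univ ∩ range 𝓘(ℝ, E))
    (h1.mono fun v h => h X) (h1.mono fun v h => h Y) mfderiv_extChartAt_one_apply (by simp)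

/-- Reduces to time `0` by `Ad (exp (r X)) = Ad (exp (t X)) Ad (exp ((r - t) X))`. -/
theorem hasDerivAt_lieAd_oneParam (X Y : E) (t : ℝ) :
    HasDerivAt (fun t => lieAd E (oneParam X t : G) Y)
      (lieAd E (oneParam X t : G) (Bracket.bracket (L := GroupLieAlgebra 𝓘(ℝ, E) G)
        (M := GroupLieAlgebra 𝓘(ℝ, E) G) X Y)) t := by
  have h := hasDerivAt_lieAd_oneParam_zero (G := G) X Y
  rw [← bracket_eq_chartMulSnd] at h
  have h1 : HasDerivAt (fun r : ℝ => r - t) 1 t := (hasDerivAt_id t).sub_const t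
  have h2 := h.scomp_of_eq t h1 (by simp)
  have h3 := (lieAd E (oneParam X t : G)).hasFDerivAt.comp_hasDerivAt t h2
  convert! h3 using 1
  · funext r
    simp only [Function.comp, ← lieAd_mul, ← oneParam_add]
    simp
  · exact congrArg _ (one_smul ℝ (_ : E)).symm

/-- If `[X, Y] = c Y`, then `Ad (exp (t X)) Y = exp (c t) Y`. -/
theorem lieAd_oneParam_of_bracket_eq_smul {X Y : E} {c : ℝ}
    (h : (Bracket.bracket (L := GroupLieAlgebra 𝓘(ℝ, E) G) (M := GroupLieAlgebra 𝓘(ℝ, E) G) X Y :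
      E) = c • Y) (t : ℝ) : lieAd E (oneParam X t : G) Y = Real.exp (c * t) • Y := by
  -- The integrating factor turns the linear equation for `Ad (exp (t X)) Y` into constancy.
  have h1 : ∀ t, HasDerivAt (fun t => Real.exp (-(c * t)) • lieAd E (oneParam X t : G) Y) 0 t := by
    intro t
    have h2 := hasDerivAt_lieAd_oneParam (G := G) X Y t
    rw [h, map_smul] at h2
    have h3 : HasDerivAt (fun t => Real.exp (-(c * t))) (Real.exp (-(c * t)) * (-c)) t := by
      simpa using (((hasDerivAt_id t).const_mul c).neg).exp
    convert! h3.smul h2 using 1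
    module
  have h4 := is_const_of_deriv_eq_zero (fun t => (h1 t).differentiableAt)
    (fun t => (h1 t).deriv) t 0
  simp only [mul_zero, neg_zero, Real.exp_zero, one_smul, oneParam_zero, lieAd_one] at h4
  conv_rhs => rw [← h4, smul_smul, ← Real.exp_add]
  simp

end AdjointDerivative

/-! ### Absolute continuity of smooth functions along curves -/

section SmoothFunctionAlongCurve

variable {E : Type*} [NormedAddCommGroup E] [NormedSpace ℝ E]
  {G : Type*} [TopologicalSpace G] [ChartedSpace E G] [Group G] [LieGroup 𝓘(ℝ, E) ∞ G]

/-- The derivative of `f` along a left-invariant vector field. -/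
noncomputable def leftInvariantDeriv (E : Type*) [NormedAddCommGroup E] [NormedSpace ℝ E]
    {G : Type*} [TopologicalSpace G] [ChartedSpace E G] [Group G] (f : G → ℝ) (g : G) :
    E →L[ℝ] ℝ :=
  ContinuousLinearMap.comp (mfderiv 𝓘(ℝ, E) 𝓘(ℝ, ℝ) f g : E →L[ℝ] ℝ)
    (mfderiv 𝓘(ℝ, E) 𝓘(ℝ, E) (g * ·) (1 : G) : E →L[ℝ] E)

theorem continuous_leftInvariantDeriv {f : G → ℝ} (hf : ContMDiff 𝓘(ℝ, E) 𝓘(ℝ, ℝ) ∞ f) (X : E) :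
    Continuous fun g => leftInvariantDeriv E f g X := by
  have h1 := (contMDiff_one_mulInvariantVectorField (E := E) (G := G) X).continuous
  have h2 : Continuous (tangentMap 𝓘(ℝ, E) 𝓘(ℝ, ℝ) f) := hf.continuous_tangentMap (by simp)
  exact contMDiff_snd_tangentBundle_modelSpace ℝ 𝓘(ℝ, ℝ) (n := 1) |>.continuous.comp (h2.comp h1)

theorem HasVelocityAt.hasDerivAt_comp {f : G → ℝ} (hf : ContMDiff 𝓘(ℝ, E) 𝓘(ℝ, ℝ) ∞ f)
    {γ : ℝ → G} {ξ : E} {t : ℝ} (h : HasVelocityAt γ ξ t) :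
    HasDerivAt (fun r => f (γ r)) (leftInvariantDeriv E f (γ t) ξ) t := by
  have h1 := (hf.mdifferentiable (by simp) (γ t)).hasMFDerivAt.comp t (hasVelocityAt_iff.1 h)
  have h2 := comp_one_smulRight (E := E) (F := ℝ) (mfderiv 𝓘(ℝ, E) 𝓘(ℝ, ℝ) f (γ t) : E →L[ℝ] ℝ)
    (ξ := mulInvariantVectorField (I := 𝓘(ℝ, E)) (G := G) ξ (γ t)) rfl
  have h3 : HasFDerivAt (fun r => f (γ r))
      ((1 : ℝ →L[ℝ] ℝ).smulRight (leftInvariantDeriv E f (γ t) ξ)) t :=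
    (h1.congr_mfderiv h2).hasFDerivAt
  simpa using h3.hasDerivAt

/-- With continuous controls `f ∘ γ` is even `C¹`: its derivative is a combination of the continuous
functions `e i f` along `γ`, with coefficients `c t i`. -/
theorem absolutelyContinuousOnInterval_comp {f : G → ℝ} (hf : ContMDiff 𝓘(ℝ, E) 𝓘(ℝ, ℝ) ∞ f)
    {ι : Type*} [Fintype ι] {γ : ℝ → G} {c : ℝ → ι → ℝ} (hc : Continuous c) {e : ι → E}
    (h : ∀ t, HasVelocityAt γ (∑ i, c t i • e i) t) (a b : ℝ) :
    AbsolutelyContinuousOnInterval (fun t => f (γ t)) a b := by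
  have hd := fun t => (h t).hasDerivAt_comp hf
  have hγ : Continuous γ := continuous_iff_continuousAt.2 fun t => (h t).continuousAt
  refine ContDiffOn.absolutelyContinuousOnInterval (ContDiff.contDiffOn ?_)
  rw [contDiff_one_iff_deriv]
  refine ⟨fun t => (hd t).differentiableAt, ?_⟩
  have : deriv (fun t => f (γ t)) = fun t => ∑ i, c t i * leftInvariantDeriv E f (γ t) (e i) := by
    ext t; rw [(hd t).deriv]; simp
  rw [this]
  refine continuous_finsetSum _ fun i _ => ((continuous_apply i).comp hc).mul
    ((continuous_leftInvariantDeriv hf _).comp hγ)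

end SmoothFunctionAlongCurve

/-! ### Coordinates on `p` and horizontality for continuous controls -/

namespace LeftInvariantSubRiemannian

variable {E : Type*} [NormedAddCommGroup E] [NormedSpace ℝ E]
  {G : Type*} [TopologicalSpace G] [ChartedSpace E G] [Group G]
  {ι : Type*} [Fintype ι] {e : ι → GroupLieAlgebra 𝓘(ℝ, E) G} (he : LinearIndependent ℝ e)

/-- The vector of `p` with coordinates `c` in the orthonormal basis `e`. -/
noncomputable def orthoVec (c : ι → ℝ) : (ofOrthonormal e he).p :=
  ∑ i, c i • Module.Basis.span he i

theorem coe_orthoVec (c : ι → ℝ) :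
    (orthoVec he c : GroupLieAlgebra 𝓘(ℝ, E) G) = ∑ i, c i • e i := by
  simp only [orthoVec]
  refine (map_sum (Submodule.span ℝ (range e)).subtype _ _).trans
    (Finset.sum_congr rfl fun i _ => ?_)
  rw [map_smul, Submodule.subtype_apply, Module.Basis.span_apply]

theorem norm_orthoVec (c : ι → ℝ) :
    (ofOrthonormal e he).norm (orthoVec he c) = Real.sqrt (∑ i, c i * c i) := by
  have h : (Module.Basis.span he).repr (orthoVec he c) = fun i => c i := by
    funext i
    exact congrFun ((Module.Basis.span he).repr_sum_self c) i
  show Real.sqrt (∑ i, (Module.Basis.span he).repr (orthoVec he c) i *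
    (Module.Basis.span he).repr (orthoVec he c) i) = _
  rw [h]

theorem exists_eq_orthoVec (v : (ofOrthonormal e he).p) : ∃ c, v = orthoVec he c :=
  ⟨_, ((Module.Basis.span he).sum_repr v).symm⟩

theorem isHorizontal_of_hasVelocityAt [LieGroup 𝓘(ℝ, E) ∞ G] {γ : ℝ → G} {c : ℝ → ι → ℝ}
    (hc : Continuous c)
    (h : ∀ t, HasVelocityAt (E := E) γ (∑ i, c t i • e i : GroupLieAlgebra 𝓘(ℝ, E) G) t)
    (a b : ℝ) : (ofOrthonormal e he).IsHorizontal γ (fun t => orthoVec he (c t)) a b where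
  continuousOn := (continuous_iff_continuousAt.2 fun t => (h t).continuousAt).continuousOn
  absolutelyContinuous f hf := absolutelyContinuousOnInterval_comp (E := E) hf hc h a b
  aemeasurable l := by
    have : (fun t => l (orthoVec he (c t))) =
        fun t => ∑ i, c t i * l (Module.Basis.span he i) := by
      funext t
      exact (map_sum l _ _).trans (Finset.sum_congr rfl fun i _ => l.map_smul _ _)
    rw [this]
    exact (continuous_finsetSum _ fun i _ =>
      ((continuous_apply i).comp hc).mul continuous_const).measurable.aemeasurable
  hasMFDerivAt := by
    refine ae_of_all _ fun t => ?_
    rw [coe_orthoVec]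
    exact hasVelocityAt_iff.1 (h t)

end LeftInvariantSubRiemannian

/-! ### Hyperbolic geodesics in the subgroup generated by two vectors -/

section Shortcut

set_option linter.unusedSectionVars false

variable {E : Type*} [NormedAddCommGroup E] [NormedSpace ℝ E]
  {G : Type*} [TopologicalSpace G] [ChartedSpace E G] [Group G] [LieGroup 𝓘(ℝ, E) ∞ G]
  [CompleteSpace E] [T2Space G]

/-- If `[X, Y] = -Y`, this curve is, for the left-invariant Riemannian metric with orthonormal
frame `X`, `Y` on the subgroup generated by `X` and `Y`, a geodesic of the hyperbolic plane. It
joins `exp (-sinh a Y)` to `exp (sinh a Y)` for `τ ∈ [-a, a]`, `s = 1`. -/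
noncomputable def hyperbolicGeodesic (G : Type*) [TopologicalSpace G] [ChartedSpace E G] [Group G]
    (X Y : E) (s a τ : ℝ) : G :=
  oneParam Y (s * Real.cosh a * (Real.sinh τ / Real.cosh τ)) *
    oneParam X (Real.log (Real.cosh τ / Real.cosh a))

/-- Along `exp (x Y) exp (log y X)` the velocity is `y x' Y + (y' / y) X`, so `(x, 1 / y)` are upper
half-plane coordinates. For `s = ±1` the curve is the semicircle `x² + (1 / y)² = cosh² a`, run at
unit speed; at `τ = ±a` it has `y = 1`, that is, it meets the horocycle `exp (x Y)`. -/
theorem hasVelocityAt_hyperbolicGeodesic {X Y : E}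
    (h : (Bracket.bracket (L := GroupLieAlgebra 𝓘(ℝ, E) G) (M := GroupLieAlgebra 𝓘(ℝ, E) G) X Y :
      E) = (-1 : ℝ) • Y) (s a τ : ℝ) :
    HasVelocityAt (hyperbolicGeodesic G X Y s a)
      ((s / Real.cosh τ) • Y + (Real.sinh τ / Real.cosh τ) • X) τ := by
  have hc : Real.cosh τ ≠ 0 := (Real.cosh_pos τ).ne'
  have hca : Real.cosh a ≠ 0 := (Real.cosh_pos a).ne'
  have h1 : HasDerivAt (fun τ => s * Real.cosh a * (Real.sinh τ / Real.cosh τ))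
      (s * Real.cosh a / Real.cosh τ ^ 2) τ := by
    convert! ((Real.hasDerivAt_sinh τ).div (Real.hasDerivAt_cosh τ) hc).const_mul
      (s * Real.cosh a) using 1
    have := Real.cosh_sq τ
    field_simp
    linear_combination (-s) * this
  have h2 : HasDerivAt (fun τ => Real.log (Real.cosh τ / Real.cosh a))
      (Real.sinh τ / Real.cosh τ) τ := by
    convert! ((Real.hasDerivAt_cosh τ).div_const (Real.cosh a)).log (by positivity) using 1
    field_simp
  have h3 := ((hasVelocityAt_oneParam (G := G) Y _).comp h1).mul
    ((hasVelocityAt_oneParam (G := G) X _).comp h2)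
  rw [← oneParam_neg, map_smul, lieAd_oneParam_of_bracket_eq_smul h, neg_one_mul, neg_neg,
    Real.exp_log (by positivity), smul_smul] at h3
  convert! h3 using 3
  field_simp

theorem hyperbolicGeodesic_right (X Y : E) (s a : ℝ) :
    hyperbolicGeodesic G X Y s a a = oneParam Y (s * Real.sinh a) := by
  have hc : Real.cosh a ≠ 0 := (Real.cosh_pos a).ne'
  rw [hyperbolicGeodesic, div_self hc, Real.log_one, oneParam_zero, mul_one]
  congr 1
  field_simp

theorem hyperbolicGeodesic_left (X Y : E) (s a : ℝ) :
    hyperbolicGeodesic G X Y s a (-a) = oneParam Y (-(s * Real.sinh a)) := by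
  have hc : Real.cosh a ≠ 0 := (Real.cosh_pos a).ne'
  rw [hyperbolicGeodesic, Real.cosh_neg, div_self hc, Real.log_one, oneParam_zero, mul_one,
    Real.sinh_neg]
  congr 1
  field_simp

theorem oneParam_mul_hyperbolicGeodesic_left (X Y : E) (s a r : ℝ) :
    oneParam Y (r + s * Real.sinh a) * hyperbolicGeodesic G X Y s a (-a) = oneParam Y r := by
  rw [hyperbolicGeodesic_left, ← oneParam_add, add_neg_cancel_right]

theorem oneParam_mul_hyperbolicGeodesic_right (X Y : E) (s a r : ℝ) :
    oneParam Y (r + s * Real.sinh a) * hyperbolicGeodesic G X Y s a a =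
      oneParam Y (r + s * (2 * Real.sinh a)) := by
  rw [hyperbolicGeodesic_right, ← oneParam_add]
  congr 1; ring

end Shortcut

/-! ### The curve `exp (s t E₁)` is nowhere shortest -/

section G43

open LeftInvariantSubRiemannian

variable {E : Type*} [NormedAddCommGroup E] [NormedSpace ℝ E]
  {G : Type*} [TopologicalSpace G] [ChartedSpace E G] [Group G]
  {b : Module.Basis (Fin 4) ℝ (GroupLieAlgebra 𝓘(ℝ, E) G)}

theorem linearIndependent_frame134 (b : Module.Basis (Fin 4) ℝ (GroupLieAlgebra 𝓘(ℝ, E) G)) :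
    LinearIndependent ℝ (b ∘ ![0, 2, 3]) :=
  b.linearIndependent.comp _ (by decide)

/-- The vector `x E₁ + y E₃ + z E₄`. -/
noncomputable abbrev vec134 (b : Module.Basis (Fin 4) ℝ (GroupLieAlgebra 𝓘(ℝ, E) G)) (x y z : ℝ) :
    (subRiemannian134 b).p :=
  orthoVec (linearIndependent_frame134 b) ![x, y, z]

theorem coe_vec134 (x y z : ℝ) :
    (vec134 b x y z : GroupLieAlgebra 𝓘(ℝ, E) G) = x • b 0 + y • b 2 + z • b 3 := by
  refine (coe_orthoVec _ _).trans ?_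
  simp [Fin.sum_univ_three]

theorem norm_vec134 (x y z : ℝ) :
    (subRiemannian134 b).norm (vec134 b x y z) = Real.sqrt (x * x + y * y + z * z) := by
  refine (norm_orthoVec (linearIndependent_frame134 b) _).trans ?_
  simp [Fin.sum_univ_three]

theorem exists_eq_vec134 (v : (subRiemannian134 b).p) : ∃ x y z, v = vec134 b x y z := by
  obtain ⟨c, rfl⟩ := exists_eq_orthoVec (linearIndependent_frame134 b) v
  refine ⟨c 0, c 1, c 2, ?_⟩
  unfold vec134
  congr 1
  ext i; fin_cases i <;> rfl

variable [LieGroup 𝓘(ℝ, E) ∞ G]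

theorem isHorizontal134_of_hasVelocityAt {γ : ℝ → G} {x y z : ℝ → ℝ} (hx : Continuous x)
    (hy : Continuous y) (hz : Continuous z)
    (h : ∀ t, HasVelocityAt (E := E) γ (x t • b 0 + y t • b 2 + z t • b 3) t) (r t : ℝ) :
    (subRiemannian134 b).IsHorizontal γ (fun t => vec134 b (x t) (y t) (z t)) r t := by
  refine isHorizontal_of_hasVelocityAt (linearIndependent_frame134 b) (c := fun t => ![x t, y t, z t])
    ?_ (fun t => ?_) r t
  · refine continuous_pi fun i => ?_
    fin_cases i <;> simpa
  · have : (∑ i, ![x t, y t, z t] i • (b ∘ ![0, 2, 3]) i) = x t • b 0 + y t • b 2 + z t • b 3 := by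
      simp [Fin.sum_univ_three]
    rw [this]
    exact h t

theorem hasVelocityAt_of_hasMFDerivAt {γ : ℝ → G} {v : (subRiemannian134 b).p} {t : ℝ}
    (h : HasMFDerivAt 𝓘(ℝ, ℝ) 𝓘(ℝ, E) γ t ((1 : ℝ →L[ℝ] ℝ).smulRight
      (mulInvariantVectorField (v : GroupLieAlgebra 𝓘(ℝ, E) G) (γ t)))) :
    HasVelocityAt (E := E) γ (v : GroupLieAlgebra 𝓘(ℝ, E) G) t :=
  hasVelocityAt_iff.2 h

variable [CompleteSpace E] [T2Space G]

theorem hasVelocityAt_curve (s t : ℝ) : HasVelocityAt (E := E) (G := G)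
    (fun t : ℝ => lieExp ((s * t) • b 0)) (s • b 0 + (0 : ℝ) • b 2 + (0 : ℝ) • b 3) t := by
  have h := (hasVelocityAt_oneParam (E := E) (G := G) (b 0) (s * t)).comp
    (f := fun t => s * t) (by simpa using (hasDerivAt_id t).const_mul s)
  have e : s • b 0 + (0 : ℝ) • b 2 + (0 : ℝ) • b 3 = s • b 0 := by simp
  rw [e]
  exact h

theorem isHorizontal_curve (s r t : ℝ) : (subRiemannian134 b).IsHorizontal
    (fun t : ℝ => (lieExp ((s * t) • b 0) : G)) (fun _ => vec134 b s 0 0) r t :=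
  isHorizontal134_of_hasVelocityAt continuous_const continuous_const continuous_const
    (hasVelocityAt_curve s) r t

/-- The definitions of shortest segment and of extremal only assert that some control exists;
uniqueness of velocities pins it down almost everywhere. -/
theorem ae_control_eq {s r t : ℝ} {u : ℝ → (subRiemannian134 b).p}
    (h : (subRiemannian134 b).IsHorizontal (fun t : ℝ => (lieExp ((s * t) • b 0) : G)) u r t) :
    ∀ᵐ τ ∂volume.restrict (Icc r t), u τ = vec134 b s 0 0 := by
  filter_upwards [h.hasMFDerivAt] with τ hτ
  refine Subtype.ext ?_
  rw [coe_vec134]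
  exact (hasVelocityAt_of_hasMFDerivAt hτ).unique (hasVelocityAt_curve s τ)

theorem dist_curve_le (hb : IsG43Basis b) {s : ℝ} (hs : s = 1 ∨ s = -1) {t₀ t₁ a : ℝ} (ha : 0 ≤ a)
    (h : 2 * Real.sinh a = t₁ - t₀) :
    (subRiemannian134 b).dist (lieExp ((s * t₀) • b 0) : G) (lieExp ((s * t₁) • b 0)) ≤
      ENNReal.ofReal (2 * a) := by
  have := lieGroup_minSmoothness_three E G
  have hbr : ⁅b 3, b 0⁆ = (-1 : ℝ) • b 0 := by
    rw [← lie_skew, hb.lie_one_four]; simp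
  -- The geodesic for `τ ∈ [-a, a]`, translated so as to start at `exp (s t₀ E₁)`, and run over `[0,
  -- 1]` at constant speed `2 a`.
  set δ : ℝ → G := fun t => oneParam (E := E) (b 0) (s * t₀ + s * Real.sinh a) *
    hyperbolicGeodesic (E := E) G (b 3) (b 0) s a (2 * a * t - a) with hδ
  have hv : ∀ t, HasVelocityAt (E := E) δ ((2 * a * (s / Real.cosh (2 * a * t - a))) • b 0 +
      (0 : ℝ) • b 2 + (2 * a * (Real.sinh (2 * a * t - a) / Real.cosh (2 * a * t - a))) • b 3) t := by
    intro t
    have h1 : HasDerivAt (fun t => 2 * a * t - a) (2 * a) t := by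
      simpa using ((hasDerivAt_id t).const_mul (2 * a)).sub_const a
    have h2 := ((hasVelocityAt_hyperbolicGeodesic (E := E) hbr s a (2 * a * t - a)).comp
      (f := fun t => 2 * a * t - a) h1).const_mul (oneParam (E := E) (b 0) (s * t₀ + s * Real.sinh a))
    have h3 : ∀ c₁ c₂ : ℝ, (2 * a) • (c₁ • b 0 + c₂ • b 3) =
        (2 * a * c₁) • b 0 + (0 : ℝ) • b 2 + (2 * a * c₂) • b 3 := fun c₁ c₂ => by module
    rw [← h3]
    exact h2
  have hcosh : Continuous fun t : ℝ => Real.cosh (2 * a * t - a) := by fun_prop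
  have hne : ∀ t, Real.cosh (2 * a * t - a) ≠ 0 := fun t => (Real.cosh_pos _).ne'
  have hH := isHorizontal134_of_hasVelocityAt (continuous_const.mul (continuous_const.div hcosh hne))
    continuous_const (continuous_const.mul ((by fun_prop : Continuous fun t : ℝ =>
      Real.sinh (2 * a * t - a)).div hcosh hne)) hv 0 1
  have e0 : δ 0 = lieExp ((s * t₀) • b 0) := by
    simp only [hδ, mul_zero, zero_sub]
    exact oneParam_mul_hyperbolicGeodesic_left (E := E) (b 3) (b 0) s a (s * t₀)
  have e1 : δ 1 = lieExp ((s * t₁) • b 0) := by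
    simp only [hδ, mul_one]
    rw [show 2 * a - a = a by ring, show s * t₁ = s * t₀ + s * (2 * Real.sinh a) by rw [h]; ring]
    exact oneParam_mul_hyperbolicGeodesic_right (E := E) (b 3) (b 0) s a (s * t₀)
  refine (iInf₂_le_of_le δ _ (iInf_le _ ⟨hH, e0, e1⟩)).trans ?_
  have hnorm : ∀ t : ℝ, (subRiemannian134 b).norm (vec134 b (2 * a * (s / Real.cosh (2 * a * t - a)))
      0 (2 * a * (Real.sinh (2 * a * t - a) / Real.cosh (2 * a * t - a)))) = 2 * a := by
    intro t
    have hs2 : s ^ 2 = 1 := by rcases hs with rfl | rfl <;> norm_num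
    rw [norm_vec134]
    refine Eq.trans (congrArg Real.sqrt ?_) (Real.sqrt_mul_self (by positivity : 0 ≤ 2 * a))
    have h1 := Real.cosh_sq (2 * a * t - a)
    have h2 := hne t
    generalize 2 * a * t - a = w at h1 h2 ⊢
    field_simp
    linear_combination 4 * a ^ 2 * (hs2 - h1)
  refine (lintegral_congr (g := fun _ => ENNReal.ofReal (2 * a))
    fun t => congrArg _ (hnorm t)).trans_le ?_
  simp

theorem not_isShortest_curve (hb : IsG43Basis b) {s : ℝ} (hs : s = 1 ∨ s = -1) {t₀ t₁ : ℝ}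
    (h : t₀ < t₁) : ¬ (subRiemannian134 b).IsShortest
      (fun t : ℝ => (lieExp ((s * t) • b 0) : G)) t₀ t₁ := by
  rintro ⟨u, hu, hl⟩
  have hs2 : s * s = 1 := by rcases hs with rfl | rfl <;> norm_num
  -- The shortcut has length `2 a`, against `t₁ - t₀ = 2 sinh a` for the segment.
  obtain ⟨a, ha⟩ := Real.sinh_surjective ((t₁ - t₀) / 2)
  have ha0 : 0 < a := by rw [← Real.sinh_pos_iff, ha]; linarith
  have h1 := dist_curve_le hb hs ha0.le (t₀ := t₀) (t₁ := t₁) (by rw [ha]; ring)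
  have h2 : (subRiemannian134 b).length u t₀ t₁ = ENNReal.ofReal (t₁ - t₀) := by
    rw [LeftInvariantSubRiemannian.length, lintegral_congr_ae (g := fun _ => 1)]
    · simp
    · filter_upwards [ae_control_eq hu] with t ht
      rw [ht, norm_vec134]; simp [hs2]
  rw [← hl, h2, ENNReal.ofReal_le_ofReal_iff (by positivity)] at h1
  have := Real.self_lt_sinh_iff.2 ha0
  linarith

theorem not_isGeodesic_curve (hb : IsG43Basis b) {s : ℝ} (hs : s = 1 ∨ s = -1) :
    ¬ (subRiemannian134 b).IsGeodesic (fun t : ℝ => (lieExp ((s * t) • b 0) : G)) := by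
  intro h
  obtain ⟨ε, hε, h⟩ := h 0
  exact not_isShortest_curve hb hs (by linarith : -(ε / 2) < ε / 2)
    (h _ _ (by linarith) (by linarith) (by linarith))

end G43

/-! ### The curve is abnormal and not normal -/

section Extremal

variable {E : Type*} [NormedAddCommGroup E] [NormedSpace ℝ E]
  {G : Type*} [TopologicalSpace G] [ChartedSpace E G] [Group G]
  {b : Module.Basis (Fin 4) ℝ (GroupLieAlgebra 𝓘(ℝ, E) G)} [LieGroup 𝓘(ℝ, E) ∞ G]
  [CompleteSpace E] [T2Space G]

theorem isAbnormalExtremal_curve (hb : IsG43Basis b) {s : ℝ} (hs : s = 1 ∨ s = -1) :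
    (subRiemannian134 b).IsAbnormalExtremal (fun t : ℝ => (lieExp ((s * t) • b 0) : G)) := by
  have := lieGroup_minSmoothness_three E G
  have hs2 : s * s = 1 := by rcases hs with rfl | rfl <;> norm_num
  have hv : ∀ v : (subRiemannian134 b).p, b.coord 1 v = 0 := by
    intro v
    obtain ⟨x, y, z, rfl⟩ := exists_eq_vec134 v
    rw [coe_vec134]
    simp
  -- All brackets with `E₁` are multiples of `E₁`, so the covector dual to `E₂` is a constant
  -- solution of the Hamiltonian system.
  have hbr : ∀ v, b.coord 1 ⁅s • b 0, v⁆ = 0 := by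
    intro v
    have h2 : ⁅s • b 0, v⁆ = (s * b.repr v 3) • b 0 := by
      conv_lhs => rw [← b.sum_repr v, Fin.sum_univ_four]
      simp only [smul_lie, lie_add, lie_smul, lie_self, hb.lie_one_two, hb.lie_one_three,
        hb.lie_one_four, smul_zero, zero_add, smul_smul, mul_comm s]
    rw [h2]; simp
  refine ⟨fun _ => vec134 b s 0 0, fun _ => b.coord 1, ?_⟩
  exact
    { isHorizontal := fun r t _ => isHorizontal_curve s r t
      norm_eq_one := ae_of_all _ fun t => by rw [norm_vec134]; simp [hs2]
      absolutelyContinuous := fun v r t _ =>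
        (contDiff_const.contDiffOn (n := 1)).absolutelyContinuousOnInterval
      ne_zero := fun _ h => by simpa using LinearMap.congr_fun h (b 1)
      hasDerivAt := fun v => ae_of_all _ fun t => by
        have h1 : (vec134 b s 0 0 : GroupLieAlgebra 𝓘(ℝ, E) G) = s • b 0 := by
          rw [coe_vec134]; simp
        rw [h1, hbr]
        exact hasDerivAt_const _ _
      maximum := ae_of_all _ fun t v _ => by rw [hv, hv]
      eq_maximum := ae_of_all _ fun t => hv _ }

theorem not_isNormalExtremal_curve (hb : IsG43Basis b) {s : ℝ} (hs : s = 1 ∨ s = -1) :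
    ¬ (subRiemannian134 b).IsNormalExtremal (fun t : ℝ => (lieExp ((s * t) • b 0) : G)) := by
  have := lieGroup_minSmoothness_three E G
  have hs2 : s * s = 1 := by rcases hs with rfl | rfl <;> norm_num
  rintro ⟨u, ψ, M, hM, h⟩
  have hae : ∀ {P : ℝ → Prop}, (∀ᵐ t, P t) → ∀ᵐ t ∂volume.restrict (Icc (0 : ℝ) 1), P t :=
    fun hP => ae_restrict_of_ae hP
  have hu := ae_control_eq (h.isHorizontal 0 1 one_pos)
  have hu0 : (vec134 b s 0 0 : GroupLieAlgebra 𝓘(ℝ, E) G) = s • b 0 := by rw [coe_vec134]; simp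
  have hψ : ∀ᵐ t ∂volume.restrict (Icc (0 : ℝ) 1), ψ t (s • b 0) = M := by
    filter_upwards [hu, hae h.eq_maximum] with t h1 h2
    rwa [h1, hu0] at h2
  have hz : ∀ᵐ t ∂volume.restrict (Icc (0 : ℝ) 1), ψ t (b 3) = 0 := by
    filter_upwards [hu, hψ, hae h.maximum] with t h1 h2 h3
    set k := ψ t (b 3) with hk
    set r := Real.sqrt (M * M + k * k) with hr
    have hr2 : r * r = M * M + k * k := Real.mul_self_sqrt (by nlinarith)
    have hr0 : 0 < r := Real.sqrt_pos.2 (by nlinarith)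
    -- The test vector is the unit vector of `span (E₁, E₄)` on which `ψ t` is largest. The value
    -- there is `r = √(M² + k²)`, so maximality gives `r ≤ M`, hence `k = 0`.
    have h4 := h3 (vec134 b (M / r * s) 0 (k / r)) (by
      rw [norm_vec134]
      refine Real.sqrt_le_iff.2 ⟨zero_le_one, le_of_eq ?_⟩
      field_simp
      linear_combination M ^ 2 * hs2 - hr2)
    have h5 : (M / r * s) • b 0 + (0 : ℝ) • b 2 + (k / r) • b 3 =
      (M / r) • (s • b 0) + (k / r) • b 3 := by module
    rw [h1, hu0, coe_vec134, h5, map_add, map_smul, map_smul (ψ t) (k / r), h2, ← hk] at h4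
    have h6 : M / r * M + k / r * k = r := by field_simp; linear_combination -hr2
    simp only [smul_eq_mul, h6] at h4
    have : k * k ≤ 0 := by nlinarith
    nlinarith
  have hd : ∀ᵐ t ∂volume.restrict (Icc (0 : ℝ) 1), HasDerivAt (fun r => ψ r (b 3)) M t := by
    filter_upwards [hu, hψ, hae (h.hasDerivAt (b 3))] with t h1 h2 h3
    rw [h1, hu0, smul_lie, hb.lie_one_four, h2] at h3
    exact h3
  have hio : ∀ᵐ t ∂volume.restrict (Ioo (0 : ℝ) 1), HasDerivAt (fun r => ψ r (b 3)) M t :=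
    ae_restrict_of_ae_restrict_of_subset Ioo_subset_Icc_self hd
  rw [ae_restrict_iff' measurableSet_Icc] at hz
  rw [ae_restrict_iff' measurableSet_Ioo] at hio
  obtain ⟨t, ht, htd⟩ : ∃ t ∈ Ioo (0 : ℝ) 1, HasDerivAt (fun r => ψ r (b 3)) M t := by
    by_contra! hcon
    have h1 : volume (Ioo (0 : ℝ) 1) = 0 := by
      refine measure_eq_zero_iff_ae_notMem.2 ?_
      filter_upwards [hio] with t h2 ht using hcon t ht (h2 ht)
    simp at h1
  -- One point with a nonzero derivative suffices: near it `ψ (E₄)` has no other zeros, so its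
  -- vanishing almost everywhere fails on an interval to the right of `t`.
  have hne := htd.eventually_ne (c := 0) hM.ne'
  obtain ⟨ε, hε, hne⟩ := Metric.eventually_nhds_iff_ball.1 (eventually_nhdsWithin_iff.1 hne)
  have hnull : volume (Ioo t (min (t + ε) 1)) = 0 := by
    refine measure_eq_zero_iff_ae_notMem.2 ?_
    filter_upwards [hz] with r h2 hr
    refine hne r ?_ hr.1.ne' (h2 ⟨(ht.1.trans hr.1).le, (hr.2.trans_le (min_le_right _ _)).le⟩)
    rw [Metric.mem_ball, Real.dist_eq, abs_of_pos (sub_pos.2 hr.1)]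
    linarith [hr.2.trans_le (min_le_left (t + ε) 1)]
  rw [Real.volume_Ioo, ENNReal.ofReal_eq_zero, sub_nonpos] at hnull
  exact absurd hnull (not_le.2 (lt_min (by linarith) ht.2))

end Extremal

theorem proposition7
    {E : Type*} [NormedAddCommGroup E] [NormedSpace ℝ E]
    {G : Type*} [TopologicalSpace G] [T2Space G] [ConnectedSpace G] [ChartedSpace E G] [Group G]
    [LieGroup 𝓘(ℝ, E) ∞ G]
    (b : Module.Basis (Fin 4) ℝ (GroupLieAlgebra 𝓘(ℝ, E) G)) (hb : IsG43Basis b)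
    (s : ℝ) (hs : s = 1 ∨ s = -1) :
    (subRiemannian134 b).IsStrictlyAbnormalExtremal (fun t : ℝ => lieExp ((s * t) • b 0)) ∧
    ¬ (subRiemannian134 b).IsGeodesic (fun t : ℝ => lieExp ((s * t) • b 0)) ∧
    ∀ t₀ t₁ : ℝ, t₀ < t₁ →
      ¬ (subRiemannian134 b).IsShortest (fun t : ℝ => lieExp ((s * t) • b 0)) t₀ t₁ := by
  -- As a vector space the Lie algebra is `E` itself, so the basis makes `E` finite-dimensional and
  -- hence complete, as the existence of integral curves requires.
  have : FiniteDimensional ℝ E := Module.Finite.of_basis (M := GroupLieAlgebra 𝓘(ℝ, E) G) b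
  have : CompleteSpace E := FiniteDimensional.complete ℝ E
  exact ⟨⟨isAbnormalExtremal_curve hb hs, not_isNormalExtremal_curve hb hs⟩,
    not_isGeodesic_curve hb hs, fun _ _ h => not_isShortest_curve hb hs h⟩
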